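/- Let $K$ be a nonempty compact Hausdorff space and let $C(K)$ be the space of continuous complex-valued functions on $K$ with the sup norm. Let $A\subset C(K)$ be a function algebra on $K$, i.e. a closed subalgebra of $C(K)$ that contains the constant functions and separates the points of $K$. Let $$\partial A=\{k\in K:\ \delta_k|_A \text{ is an extreme point of the closed unit ball of } A^*\},\qquad \delta_k(f)=f(k),$$ be its Choquet boundary, and suppose that $\partial A$, with the topology induced from $K$, has no isolated point. Let $T\colon A\to A$ be a bounded linear operator that satisfies at least one of the following two conditions: - $T$ is weakly compact, i.e. the image under $T$ of the closed unit ball of $A$ is relatively compact in the weak topology of $A$; - $T$ factors through a subspace of $c_0$, i.e. there are a closed subspace $E$ of the Banach space $c_0$ of complex null sequences and bounded linear operators $T_1\colon A\to E$ and $T_2\colon E\to A$ with $T=T_2T_1$. Then $T$ satisfies the Daugavet equation $$\|\mathrm{Id}+T\|=1+\|T\|.$$ -/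

import Mathlib

open scoped ContinuousMap ZeroAtInfty

section FunctionAlgebra

variable {K : Type*} [TopologicalSpace K]

/-- A function algebra on `K`: a subalgebra of `C(K)` (complex-valued functions; a `Subalgebra`
contains the constants) that is closed in the sup norm and separates the points of `K`. -/
structure IsFunctionAlgebra (A : Subalgebra ℂ C(K, ℂ)) : Prop where
  isClosed : IsClosed (A : Set C(K, ℂ))
  separatesPoints : A.SeparatesPoints

variable [CompactSpace K]

/-- The algebra `A` regarded as a complex normed space under the sup norm of `C(K)`. It is a type
of its own so that its topology is, definitionally, the one that comes from the norm. -/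
def FunctionAlgebraSpace (A : Subalgebra ℂ C(K, ℂ)) : Type _ := Subalgebra.toSubmodule A

noncomputable instance (A : Subalgebra ℂ C(K, ℂ)) : NormedAddCommGroup (FunctionAlgebraSpace A) :=
  inferInstanceAs (NormedAddCommGroup (Subalgebra.toSubmodule A))

noncomputable instance (A : Subalgebra ℂ C(K, ℂ)) : NormedSpace ℂ (FunctionAlgebraSpace A) :=
  inferInstanceAs (NormedSpace ℂ (Subalgebra.toSubmodule A))

/-- The inclusion of `A` into `C(K)`. -/
noncomputable def FunctionAlgebraSpace.incl (A : Subalgebra ℂ C(K, ℂ)) :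
    FunctionAlgebraSpace A →ₗᵢ[ℂ] C(K, ℂ) :=
  (Subalgebra.toSubmodule A).subtypeₗᵢ

/-- The restriction to `A` of the evaluation functional `f ↦ f k`. -/
noncomputable def evalFunctional (A : Subalgebra ℂ C(K, ℂ)) (k : K) :
    StrongDual ℂ (FunctionAlgebraSpace A) :=
  LinearMap.mkContinuous
    { toFun := fun f => FunctionAlgebraSpace.incl A f k
      map_add' := fun f g => by simp
      map_smul' := fun c f => by simp } 1
    (fun f => by
      rw [one_mul, ← (FunctionAlgebraSpace.incl A).norm_map f]
      exact ContinuousMap.norm_coe_le_norm _ k)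

@[simp]
theorem evalFunctional_apply (A : Subalgebra ℂ C(K, ℂ)) (k : K) (f : FunctionAlgebraSpace A) :
    evalFunctional A k f = FunctionAlgebraSpace.incl A f k := rfl

/-- The Choquet boundary of `A`: the points whose evaluation functional on `A` is an extreme
point of the closed unit ball of the dual space of `A`. -/
def choquetBoundary (A : Subalgebra ℂ C(K, ℂ)) : Set K :=
  {k | evalFunctional A k ∈
    Set.extremePoints ℝ (Metric.closedBall (0 : StrongDual ℂ (FunctionAlgebraSpace A)) 1)}

end FunctionAlgebra

section Operators

variable {X Y : Type*} [NormedAddCommGroup X] [NormedSpace ℂ X]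
  [NormedAddCommGroup Y] [NormedSpace ℂ Y]

/-- A bounded operator is weakly compact if the image of the closed unit ball is relatively
compact in the weak topology. -/
def IsWeaklyCompactOperator (T : X →L[ℂ] Y) : Prop :=
  IsCompact (closure (toWeakSpace ℂ Y '' (T '' Metric.closedBall (0 : X) 1)))

/-- `T` factors, through bounded operators, through a closed subspace of `c₀`, the sup-normed
space `C₀(ℕ, ℂ)` of complex null sequences. -/
def FactorsThroughSubspaceOfC0 (T : X →L[ℂ] Y) : Prop :=
  ∃ E : Submodule ℂ C₀(ℕ, ℂ), IsClosed (E : Set C₀(ℕ, ℂ)) ∧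
    ∃ (T₁ : X →L[ℂ] E) (T₂ : E →L[ℂ] Y), T = T₂.comp T₁

end Operators

/-!
The Daugavet equation follows once `T f` is small at `s` for suitable functions `f ∈ A` peaking at
`s`, where `s` may be chosen in any given relatively open piece of the Choquet boundary `∂A`
(`norm_id_add_eq_of_small_at_peak`). Indeed, let `‖g‖ ≤ 1` and let `T g` almost attain `‖T‖` on an
open set `O`; then `O` meets `∂A`. Replacing `g` by `g (1 - f) + f`, with `f` peaking at
`s ∈ O ∩ ∂A`, changes the value at `s` to one and hardly changes `T g` at `s`. The norm stays almost
one because the values of `f` satisfy `|f| + |1 - f| ≤ 1 + ε`.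

*Peak functions.* Let `φ` be an extreme state of `A`. By Hahn-Banach and extremality, each positive
extension of `φ` to `C(K)` annihilates `|g|²` for `g ∈ A` with `φ g = 0`; dually, finite sums of such
`|g|²` are dominated by real parts of functions of `A` that are small at `φ`
(`exists_re_ge_sum_sq`). Hence extreme states are point evaluations (`exists_eq_evalFunctional`), so
by Krein-Milman real parts of functions of `A` attain their maxima on `∂A`
(`exists_mem_choquetBoundary_isMax_re`). Exponentials of the dominating functions are almost peak
functions (`exists_almost_peak`), and averages of these over nested neighbourhoods have values near
`[0, 1]` (`exists_isPeakingAt`). Functions peaking at distinct points are almost disjoint, so a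
functional cannot be large on functions peaking at many points
(`card_mul_le_of_forall_isPeakingAt`). By Baire's theorem in `A`, relatively open nonempty pieces of
`∂A` are uncountable (`exists_mem_choquetBoundary_notMem_countable`).

*Weakly compact `T`.* If `T f` stays large at `s` for functions `f` peaking at `s`, then so does a
weak cluster point `h ∈ A` of these `T f`, and `h` is large near `s` by continuity. If this happened
at all `s` in an open piece of `∂A`, there would be points `t` at which the functional `f ↦ T f t`
is large on functions peaking at any prescribed number of points.

*`T` through a subspace of `c₀`.* Let `T = T₂ T₁`. Outside a countable set of points `s`, every
coordinate of `T₁ f` is small for functions `f` peaking near enough to `s`. Averaging functions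
peaking at such an `s`, whose images under `T₁` form a gliding hump in `c₀`, makes the norm of
`T₁ f`, and hence that of `T f`, small.
-/

open Set Filter Topology

/-! ### States of a function algebra and their positive extensions -/

section States

variable {K : Type*} [TopologicalSpace K] [CompactSpace K] {A : Subalgebra ℂ C(K, ℂ)}

namespace FunctionAlgebraSpace

/-- An element of the subalgebra `A`, as a point of the normed space `FunctionAlgebraSpace A`. -/
noncomputable def ofMem (f : C(K, ℂ)) (hf : f ∈ A) : FunctionAlgebraSpace A :=
  (⟨f, hf⟩ : Subalgebra.toSubmodule A)

@[simp]
theorem incl_ofMem (f : C(K, ℂ)) (hf : f ∈ A) : incl A (ofMem f hf) = f := rfl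

theorem incl_mem (f : FunctionAlgebraSpace A) : incl A f ∈ A :=
  Subtype.property (p := (· ∈ Subalgebra.toSubmodule A)) f

theorem norm_apply_le (f : FunctionAlgebraSpace A) (x : K) : ‖incl A f x‖ ≤ ‖f‖ := by
  rw [← (incl A).norm_map f]
  exact ContinuousMap.norm_coe_le_norm _ x

theorem norm_le_of_forall_le {f : FunctionAlgebraSpace A} {C : ℝ} (hC : 0 ≤ C)
    (h : ∀ x, ‖incl A f x‖ ≤ C) : ‖f‖ ≤ C := by
  rw [← (incl A).norm_map f]
  exact (ContinuousMap.norm_le _ hC).2 h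

end FunctionAlgebraSpace

open FunctionAlgebraSpace

/-- The constant function `1`, as a point of `FunctionAlgebraSpace A`. -/
noncomputable def FunctionAlgebraSpace.unit (A : Subalgebra ℂ C(K, ℂ)) : FunctionAlgebraSpace A :=
  ofMem 1 A.one_mem

@[simp]
theorem FunctionAlgebraSpace.incl_unit_apply (x : K) : incl A (unit A) x = 1 := rfl

theorem norm_evalFunctional_le (k : K) : ‖evalFunctional A k‖ ≤ 1 :=
  ContinuousLinearMap.opNorm_le_bound _ zero_le_one fun f => by
    simpa using norm_apply_le f k

/-- A complex functional is bounded by one as soon as its real part is. -/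
theorem norm_le_one_of_re_le {X : Type*} [NormedAddCommGroup X] [NormedSpace ℂ X]
    {χ : StrongDual ℂ X} (h : ∀ f, (χ f).re ≤ ‖f‖) : ‖χ‖ ≤ 1 := by
  refine ContinuousLinearMap.opNorm_le_bound _ zero_le_one fun f => ?_
  obtain ⟨c, hc, hcf⟩ := RCLike.exists_norm_eq_mul_self (χ f)
  have h1 := h (c • f)
  rw [map_smul, smul_eq_mul, ← hcf, norm_smul, hc] at h1
  simpa using h1

/-- States are positive. -/
theorem re_apply_nonneg_of_state {φ : StrongDual ℂ (FunctionAlgebraSpace A)} (hφ : ‖φ‖ ≤ 1)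
    (h1 : φ (unit A) = 1) {f : FunctionAlgebraSpace A} (hf : ∀ x, 0 ≤ (incl A f x).re) :
    0 ≤ (φ f).re := by
  have key : ∀ t : ℝ, 0 < t → -(t * ‖f‖ ^ 2 / 2) ≤ (φ f).re := by
    intro t ht
    have hb : ‖unit A - (t : ℂ) • f‖ ≤ 1 + t ^ 2 * ‖f‖ ^ 2 / 2 := by
      refine norm_le_of_forall_le (by positivity) fun x => ?_
      have hx := norm_apply_le f x
      have hfx := hf x
      have h2 : ‖incl A f x‖ ^ 2 ≤ ‖f‖ ^ 2 := by gcongr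
      refine abs_le_of_sq_le_sq' ?_ (by positivity) |>.2
      rw [map_sub, map_smul, ContinuousMap.sub_apply, ContinuousMap.smul_apply, incl_unit_apply]
      rw [Complex.sq_norm, Complex.normSq_apply] at *
      simp only [smul_eq_mul, Complex.sub_re, Complex.one_re, Complex.re_ofReal_mul,
        Complex.sub_im, Complex.one_im, Complex.im_ofReal_mul]
      have h3 := mul_le_mul_of_nonneg_left h2 (sq_nonneg t)
      have h4 := mul_nonneg ht.le hfx
      nlinarith [sq_nonneg (t ^ 2 * ‖f‖ ^ 2 / 2)]
    have h5 : (φ (unit A - (t : ℂ) • f)).re ≤ 1 + t ^ 2 * ‖f‖ ^ 2 / 2 :=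
      (Complex.re_le_norm _).trans ((φ.le_of_opNorm_le hφ _).trans (by linarith))
    rw [map_sub, map_smul, h1, smul_eq_mul, Complex.sub_re, Complex.one_re,
      Complex.re_ofReal_mul] at h5
    have h6 : t * (-(t * ‖f‖ ^ 2 / 2)) ≤ t * (φ f).re := by nlinarith
    exact le_of_mul_le_mul_left h6 ht
  have hlim : Tendsto (fun t : ℝ => -(t * ‖f‖ ^ 2 / 2)) (𝓝[>] 0) (𝓝 0) := by
    have : Tendsto (fun t : ℝ => -(t * ‖f‖ ^ 2 / 2)) (𝓝 0) (𝓝 (-(0 * ‖f‖ ^ 2 / 2))) := by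
      apply Continuous.tendsto; fun_prop
    simpa using this.mono_left nhdsWithin_le_nhds
  exact le_of_tendsto hlim (eventually_mem_nhdsWithin.mono fun t ht => key t ht)

/-- A state extends to a positive functional on `C(K)`, given here by its real part. The extension
is made large on the functions whose real part dominates `h`, as far as positivity allows. -/
theorem exists_positive_extension {φ : StrongDual ℂ (FunctionAlgebraSpace A)} (hφ : ‖φ‖ ≤ 1)
    (h1 : φ (unit A) = 1) {h : K → ℝ} {ε : ℝ}
    (hh : ∀ f : FunctionAlgebraSpace A, (∀ x, h x ≤ (incl A f x).re) → ε ≤ (φ f).re) :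
    ∃ Λ : C(K, ℂ) →ₗ[ℝ] ℝ, (∀ f, Λ (incl A f) = (φ f).re) ∧
      (∀ u : C(K, ℂ), (∀ x, 0 ≤ (u x).re) → 0 ≤ Λ u) ∧
      ∀ u : C(K, ℂ), (∀ x, h x ≤ (u x).re) → ε ≤ Λ u := by
  -- Positivity on this cone gives both `0 ≤ Λ u` for `0 ≤ Re u` and `ε ≤ Λ u` for `h ≤ Re u`.
  let s : PointedCone ℝ C(K, ℂ) :=
    { carrier := {u | ∃ t : ℝ, 0 ≤ t ∧ ∀ x, t * (h x - ε) ≤ (u x).re}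
      zero_mem' := ⟨0, le_rfl, fun x => by simp⟩
      add_mem' := by
        rintro u v ⟨t, ht, hu⟩ ⟨r, hr, hv⟩
        refine ⟨t + r, by positivity, fun x => ?_⟩
        have := hu x
        have := hv x
        simp only [ContinuousMap.add_apply, Complex.add_re]
        linarith
      smul_mem' := by
        rintro ⟨c, hc⟩ u ⟨t, ht, hu⟩
        refine ⟨c * t, mul_nonneg hc ht, fun x => ?_⟩
        have := mul_le_mul_of_nonneg_left (hu x) hc
        change _ ≤ (c • u x).re
        rw [Complex.real_smul, Complex.re_ofReal_mul]
        linarith }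
  let p : C(K, ℂ) →ₗ.[ℝ] ℝ :=
    { domain := (Subalgebra.toSubmodule A).restrictScalars ℝ
      toFun :=
        { toFun := fun f => (φ (ofMem f.1 f.2)).re
          map_add' := fun f g => by
            rw [← Complex.add_re, ← map_add]; rfl
          map_smul' := fun c f => by
            rw [RingHom.id_apply, smul_eq_mul, ← Complex.re_ofReal_mul, ← smul_eq_mul,
              ← map_smul]; rfl } }
  have hadd : ∀ (f : FunctionAlgebraSpace A) (c : ℝ),
      (φ (f + (c : ℂ) • unit A)).re = (φ f).re + c := by
    intro f c
    simp [h1]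
  obtain ⟨Λ, hΛ, hpos⟩ := riesz_extension s p (by
    rintro ⟨f, hfp⟩ ⟨t, ht, hu⟩
    have hf : f ∈ A := hfp
    change 0 ≤ (φ (ofMem f hf)).re
    change ∀ x, _ ≤ (f x).re at hu
    rcases ht.eq_or_lt with rfl | ht
    · exact re_apply_nonneg_of_state hφ h1 fun x => by
        rw [incl_ofMem]; simpa using hu x
    · have := hh ((t⁻¹ : ℂ) • ofMem f hf + (ε : ℂ) • unit A) fun x => by
        have h2 := mul_le_mul_of_nonneg_left (hu x) (inv_nonneg.2 ht.le)
        rw [← mul_assoc, inv_mul_cancel₀ ht.ne', one_mul] at h2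
        have h3 : (incl A ((t⁻¹ : ℂ) • ofMem f hf + (ε : ℂ) • unit A) x).re
            = t⁻¹ * (f x).re + ε := by
          rw [map_add, map_smul, map_smul, ContinuousMap.add_apply, ContinuousMap.smul_apply,
            ContinuousMap.smul_apply, incl_unit_apply, incl_ofMem, ← Complex.ofReal_inv]
          simp
        rw [h3]; linarith
      rw [hadd, map_smul, smul_eq_mul, ← Complex.ofReal_inv, Complex.re_ofReal_mul] at this
      have h4 : 0 ≤ t⁻¹ * (φ (ofMem f hf)).re := by linarith
      exact nonneg_of_mul_nonneg_right h4 (inv_pos.2 ht)) (by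
    intro y
    refine ⟨⟨((‖y‖ : ℂ) • (1 : C(K, ℂ))), A.smul_mem A.one_mem _⟩, 0, le_rfl, fun x => ?_⟩
    have := (Complex.abs_re_le_norm (y x)).trans (y.norm_coe_le_norm x)
    have := (abs_le.1 this).1
    simp
    linarith)
  have hΛ' : ∀ f, Λ (incl A f) = (φ f).re := fun f => hΛ ⟨incl A f, incl_mem f⟩
  refine ⟨Λ, hΛ', fun u hu => hpos u ⟨0, le_rfl, fun x => by simpa using hu x⟩, fun u hu => ?_⟩
  have := hpos (u - incl A ((ε : ℂ) • unit A)) ⟨1, zero_le_one, fun x => by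
    have := hu x
    rw [map_smul, ContinuousMap.sub_apply, ContinuousMap.smul_apply, incl_unit_apply]
    simp
    linarith⟩
  rw [map_sub, hΛ'] at this
  simpa [h1] using this

end States

/-! ### The Choquet boundary -/

section ChoquetBoundary

variable {K : Type*} [TopologicalSpace K] [CompactSpace K] {A : Subalgebra ℂ C(K, ℂ)}

open FunctionAlgebraSpace

/-- A positive extension of an extreme state `φ` annihilates `(Re g)²` for all `g` in the kernel
of `φ`: after scaling, `φ` is the midpoint of the states with densities `1 ± Re g`. -/
theorem positive_extension_sq_re_eq_zero {φ : StrongDual ℂ (FunctionAlgebraSpace A)}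
    (hφ : φ ∈ Set.extremePoints ℝ
      (Metric.closedBall (0 : StrongDual ℂ (FunctionAlgebraSpace A)) 1))
    (h1 : φ (unit A) = 1) {Λ : C(K, ℂ) →ₗ[ℝ] ℝ} (hΛ : ∀ f, Λ (incl A f) = (φ f).re)
    (hpos : ∀ u : C(K, ℂ), (∀ x, 0 ≤ (u x).re) → 0 ≤ Λ u)
    {g : FunctionAlgebraSpace A} (hg : φ g = 0) {u : C(K, ℂ)}
    (hu : ∀ x, (u x).re = (incl A g x).re ^ 2) : Λ u = 0 := by
  have hre : ∀ u v : C(K, ℂ), (∀ x, (u x).re ≤ (v x).re) → Λ u ≤ Λ v := fun u v huv => by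
    have := hpos (v - u) fun x => by
      rw [ContinuousMap.sub_apply, Complex.sub_re]; linarith [huv x]
    rw [map_sub] at this
    linarith
  have hΛ1 : ∀ c : ℝ, Λ (c • 1) = c := fun c => by
    rw [map_smul, show (1 : C(K, ℂ)) = incl A (unit A) from rfl, hΛ, h1]
    simp
  have hnorm : ∀ u : C(K, ℂ), |Λ u| ≤ ‖u‖ := fun u => by
    have hx : ∀ x, |(u x).re| ≤ ‖u‖ := fun x =>
      (Complex.abs_re_le_norm _).trans (u.norm_coe_le_norm x)
    rw [abs_le, ← hΛ1 ‖u‖, ← map_neg]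
    exact ⟨hre _ _ fun x => by simpa using (abs_le.1 (hx x)).1,
      hre _ _ fun x => by simpa using (abs_le.1 (hx x)).2⟩
  let w : C(K, ℂ) := ⟨fun x => ((incl A g x).re : ℂ), by fun_prop⟩
  have hw : ∀ x, w x = ((incl A g x).re : ℂ) := fun x => rfl
  have hΛw : Λ w = 0 := by
    have : Λ w = Λ (incl A g) := le_antisymm (hre _ _ fun x => by simp [hw])
      (hre _ _ fun x => by simp [hw])
    rw [this, hΛ, hg, Complex.zero_re]
  set c : ℝ := (‖g‖ + 1)⁻¹ with hc
  have hc0 : 0 < c := by positivity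
  have hcw : ∀ x, |c * (incl A g x).re| ≤ 1 := fun x => by
    rw [abs_mul, abs_of_pos hc0, hc, inv_mul_le_iff₀ (by positivity)]
    have := (Complex.abs_re_le_norm _).trans (norm_apply_le g x)
    linarith
  let ρ : StrongDual ℝ (FunctionAlgebraSpace A) :=
    LinearMap.mkContinuous
      { toFun := fun f => Λ ((c • w) * incl A f)
        map_add' := fun f f' => by rw [map_add, mul_add, map_add]
        map_smul' := fun r f => by
          rw [← map_smul, ← mul_smul_comm]; rfl } ‖c • w‖ (fun f => by
        refine (hnorm _).trans ((norm_mul_le _ _).trans ?_)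
        rw [(incl A).norm_map])
  have hρ : ∀ f, ρ f = Λ ((c • w) * incl A f) := fun f => rfl
  let ψ : StrongDual ℂ (FunctionAlgebraSpace A) := StrongDual.extendRCLike (𝕜 := ℂ) ρ
  have hψ : ∀ f, (ψ f).re = Λ ((c • w) * incl A f) := fun f => by
    rw [← hρ]
    exact StrongDual.re_extendRCLike_apply (𝕜 := ℂ) ρ f
  -- For a sign `σ`, the state with density `1 + σ c Re g` has norm at most one.
  have hball : ∀ σ : ℝ, |σ| ≤ 1 → φ + (σ : ℂ) • ψ ∈
      Metric.closedBall (0 : StrongDual ℂ (FunctionAlgebraSpace A)) 1 := by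
    intro σ hσ
    rw [mem_closedBall_zero_iff]
    refine norm_le_one_of_re_le fun f => ?_
    have h2 : ((φ + (σ : ℂ) • ψ) f).re = Λ (incl A f + σ • ((c • w) * incl A f)) := by
      rw [map_add, map_smul, hΛ, ← hψ]
      simp
    have h3 : ‖f‖ = Λ (‖f‖ • 1 + (σ * ‖f‖ * c) • w) := by
      rw [map_add, map_smul Λ _ w, hΛw, hΛ1]; simp
    rw [h2, h3]
    refine hre _ _ fun x => ?_
    have h4 := hcw x
    have h5 : |σ * (c * (incl A g x).re)| ≤ 1 := by
      rw [abs_mul]; exact mul_le_one₀ hσ (abs_nonneg _) h4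
    have h6 := (abs_le.1 h5).1
    have h7 := (Complex.re_le_norm _).trans (norm_apply_le f x)
    have h8 : ((incl A f + σ • ((c • w) * incl A f)) x).re
        = (1 + σ * (c * (incl A g x).re)) * (incl A f x).re := by
      simp [hw]; ring
    have h9 : ((‖f‖ • (1 : C(K, ℂ)) + (σ * ‖f‖ * c) • w) x).re
        = (1 + σ * (c * (incl A g x).re)) * ‖f‖ := by
      simp [hw]; ring
    rw [h8, h9]
    exact mul_le_mul_of_nonneg_left h7 (by linarith)
  have hψ0 : φ + ((1 : ℝ) : ℂ) • ψ = φ :=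
    (mem_extremePoints.1 hφ).2 _ (hball 1 (by simp)) _ (hball (-1) (by simp))
      ⟨1 / 2, 1 / 2, by norm_num, by norm_num, by norm_num, by
        ext f
        simp
        ring⟩ |>.1
  have hψ1 : ψ = 0 := by simpa using hψ0
  have h10 : Λ (c • u) = 0 := by
    have h11 := hψ g
    rw [hψ1] at h11
    have h12 : Λ (c • u) = Λ ((c • w) * incl A g) := by
      have : ∀ x, ((c • u) x).re = (((c • w) * incl A g) x).re := fun x => by
        have h13 : (((c • w) * incl A g) x).re = c * ((incl A g x).re * (incl A g x).re) := by
          simp [hw]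
        have h14 : ((c • u) x).re = c * (u x).re := by simp
        rw [h13, h14, hu, sq]
      exact le_antisymm (hre _ _ fun x => (this x).le) (hre _ _ fun x => (this x).ge)
    rw [h12, ← h11]; simp
  rw [map_smul, smul_eq_mul] at h10
  exact (mul_eq_zero.1 h10).resolve_left hc0.ne'

/-- If finitely many functions of `A` vanish at an extreme state `φ`, the sum of the squares of
their moduli is dominated by the real part of a function of `A` that is small at `φ`. -/
theorem exists_re_ge_sum_sq {φ : StrongDual ℂ (FunctionAlgebraSpace A)}
    (hφ : φ ∈ Set.extremePoints ℝ
      (Metric.closedBall (0 : StrongDual ℂ (FunctionAlgebraSpace A)) 1))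
    (h1 : φ (unit A) = 1) (s : Finset (FunctionAlgebraSpace A)) (hs : ∀ g ∈ s, φ g = 0)
    {ε : ℝ} (hε : 0 < ε) :
    ∃ f : FunctionAlgebraSpace A, (∀ x, ∑ g ∈ s, ‖incl A g x‖ ^ 2 ≤ (incl A f x).re) ∧
      (φ f).re < ε := by
  by_contra! hcon
  obtain ⟨Λ, hΛ, hpos, hbig⟩ :=
    exists_positive_extension (mem_closedBall_zero_iff.1 hφ.1) h1 hcon
  let R : FunctionAlgebraSpace A → C(K, ℂ) :=
    fun g => ⟨fun x => (((incl A g x).re ^ 2 : ℝ) : ℂ), by fun_prop⟩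
  have hR : ∀ g, φ g = 0 → Λ (R g) = 0 := fun g hg =>
    positive_extension_sq_re_eq_zero hφ h1 hΛ hpos hg fun x => Complex.ofReal_re _
  have h2 : Λ (∑ g ∈ s, (R g + R (Complex.I • g))) = 0 := by
    rw [map_sum]
    refine Finset.sum_eq_zero fun g hg => ?_
    rw [map_add, hR g (hs g hg), hR _ (by rw [map_smul, hs g hg, smul_zero]), add_zero]
  have h3 := hbig (∑ g ∈ s, (R g + R (Complex.I • g))) fun x => by
    rw [ContinuousMap.sum_apply, Complex.re_sum]
    refine Finset.sum_le_sum fun g _ => le_of_eq ?_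
    rw [ContinuousMap.add_apply]
    change _ = ((((incl A g x).re ^ 2 : ℝ) : ℂ) + (((incl A (Complex.I • g) x).re ^ 2 : ℝ) : ℂ)).re
    rw [map_smul, ← Complex.ofReal_add, Complex.ofReal_re, Complex.sq_norm, Complex.normSq_apply]
    simp
    ring
  linarith

/-- The extreme points of the dual unit ball that are states are point evaluations. -/
theorem exists_eq_evalFunctional [Nonempty K] {φ : StrongDual ℂ (FunctionAlgebraSpace A)}
    (hφ : φ ∈ Set.extremePoints ℝ
      (Metric.closedBall (0 : StrongDual ℂ (FunctionAlgebraSpace A)) 1))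
    (h1 : φ (unit A) = 1) : ∃ k, φ = evalFunctional A k := by
  by_contra! hcon
  have h2 : ∀ k : K, ∃ g : FunctionAlgebraSpace A, φ g = 0 ∧ 1 < ‖incl A g k‖ := by
    intro k
    obtain ⟨f, hf⟩ : ∃ f, φ f ≠ evalFunctional A k f := by
      by_contra! h
      exact hcon k (ContinuousLinearMap.ext h)
    have hne : ‖incl A (f - φ f • unit A) k‖ ≠ 0 := by
      rw [map_sub, map_smul, ContinuousMap.sub_apply, ContinuousMap.smul_apply, incl_unit_apply,
        norm_ne_zero_iff, smul_eq_mul, mul_one, sub_ne_zero]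
      exact hf.symm
    refine ⟨((2 / ‖incl A (f - φ f • unit A) k‖ : ℝ) : ℂ) • (f - φ f • unit A), ?_, ?_⟩
    · rw [map_smul, map_sub φ, map_smul φ, h1]; simp
    · rw [map_smul, ContinuousMap.smul_apply, norm_smul, Complex.norm_real, norm_div, norm_norm,
        div_mul_cancel₀ _ hne]
      norm_num
  choose g hg0 hg1 using h2
  obtain ⟨t, ht⟩ := (isCompact_univ (X := K)).elim_finite_subcover
    (fun k => {x | 1 < ‖incl A (g k) x‖})
    (fun k => isOpen_lt continuous_const (by fun_prop))
    (fun k _ => mem_iUnion.2 ⟨k, hg1 k⟩)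
  classical
  obtain ⟨f, hf, hfφ⟩ := exists_re_ge_sum_sq hφ h1 (t.image g)
    (fun x hx => by obtain ⟨k, _, rfl⟩ := Finset.mem_image.1 hx; exact hg0 k) one_pos
  have h3 := re_apply_nonneg_of_state (mem_closedBall_zero_iff.1 hφ.1) h1 (f := f - unit A)
    fun x => by
      obtain ⟨k, hk, hkx⟩ := mem_iUnion₂.1 (ht (mem_univ x))
      have h4 : ‖incl A (g k) x‖ ^ 2 ≤ ∑ g ∈ t.image g, ‖incl A g x‖ ^ 2 :=
        Finset.single_le_sum (f := fun g => ‖incl A g x‖ ^ 2) (fun _ _ => by positivity)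
          (Finset.mem_image_of_mem g hk)
      have h5 : (1 : ℝ) < ‖incl A (g k) x‖ := hkx
      rw [map_sub, ContinuousMap.sub_apply, incl_unit_apply, Complex.sub_re, Complex.one_re]
      nlinarith [hf x]
  rw [map_sub, h1, Complex.sub_re, Complex.one_re] at h3
  linarith

/-- The real part of each function of `A` attains its maximum on the Choquet boundary. -/
theorem exists_mem_choquetBoundary_isMax_re [Nonempty K] (g : FunctionAlgebraSpace A) :
    ∃ k ∈ choquetBoundary A, ∀ x, (incl A g x).re ≤ (incl A g k).re := by
  obtain ⟨m, -, hm⟩ := (isCompact_univ (X := K)).exists_isMaxOn univ_nonempty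
    (f := fun x => (incl A g x).re) (by fun_prop)
  replace hm : ∀ x, (incl A g x).re ≤ (incl A g m).re := fun x => hm (mem_univ x)
  let B : Set (StrongDual ℂ (FunctionAlgebraSpace A)) := Metric.closedBall 0 1
  let F : Set (WeakDual ℂ (FunctionAlgebraSpace A)) :=
    (WeakDual.toStrongDual ⁻¹' B) ∩ ({φ | φ (unit A) = 1} ∩ {φ | (φ g).re = (incl A g m).re})
  have hFc : IsCompact F := by
    refine (WeakDual.isCompact_closedBall (𝕜 := ℂ) 0 1).inter_right (IsClosed.inter ?_ ?_)
    · exact isClosed_eq (WeakDual.eval_continuous _) continuous_const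
    · exact isClosed_eq (Complex.continuous_re.comp (WeakDual.eval_continuous _)) continuous_const
  have hFn : F.Nonempty := ⟨StrongDual.toWeakDual (evalFunctional A m),
    mem_closedBall_zero_iff.2 (norm_evalFunctional_le m), rfl, rfl⟩
  have hlc : LocallyConvexSpace ℝ (WeakDual ℂ (FunctionAlgebraSpace A)) :=
    inferInstanceAs (LocallyConvexSpace ℝ (WeakBilin (topDualPairing ℂ (FunctionAlgebraSpace A))))
  obtain ⟨φ, hφ⟩ := hFc.extremePoints_nonempty hFn
  obtain ⟨⟨hφB, hφ1, hφg⟩, hφe⟩ := hφ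
  -- The face `F` is extreme in the dual unit ball, so that its extreme point `φ` is one of `B`.
  have hstate : ∀ χ ∈ B, (1 : ℝ) ≤ (χ (unit A)).re → χ (unit A) = 1 := by
    intro χ hχ h
    have hn : ‖unit A‖ ≤ 1 := norm_le_of_forall_le zero_le_one fun x => by simp
    have h2 : ‖χ (unit A)‖ ≤ 1 :=
      (χ.le_of_opNorm_le (mem_closedBall_zero_iff.1 hχ) _).trans (by linarith)
    have h3 := Complex.sq_norm (χ (unit A))
    rw [Complex.normSq_apply] at h3
    have h4 : ‖χ (unit A)‖ ^ 2 ≤ 1 := by nlinarith [norm_nonneg (χ (unit A))]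
    apply Complex.ext
    · rw [Complex.one_re]; nlinarith
    · rw [Complex.one_im]; nlinarith
  have hmax : ∀ χ ∈ B, χ (unit A) = 1 → (χ g).re ≤ (incl A g m).re := by
    intro χ hχ h1
    have := re_apply_nonneg_of_state (mem_closedBall_zero_iff.1 hχ) h1
      (f := ((incl A g m).re : ℂ) • unit A - g) fun x => by
        rw [map_sub, map_smul, ContinuousMap.sub_apply, ContinuousMap.smul_apply, incl_unit_apply]
        simpa using hm x
    rw [map_sub, map_smul, h1] at this
    simpa using this
  let Φ : StrongDual ℂ (FunctionAlgebraSpace A) := WeakDual.toStrongDual φ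
  have hΦ1 : Φ (unit A) = 1 := hφ1
  have hΦg : (Φ g).re = (incl A g m).re := hφg
  have hext : Φ ∈ Set.extremePoints ℝ B := by
    refine ⟨hφB, fun χ₁ hχ₁ χ₂ hχ₂ hseg => ?_⟩
    obtain ⟨a, b, ha, hb, hab, hΦ⟩ := hseg
    have hval : ∀ f, (Φ f).re = a * (χ₁ f).re + b * (χ₂ f).re := fun f => by
      rw [← hΦ]; simp
    have hle : ∀ χ ∈ B, (χ (unit A)).re ≤ 1 := fun χ hχ => by
      have hn : ‖unit A‖ ≤ 1 := norm_le_of_forall_le zero_le_one fun x => by simp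
      exact (Complex.re_le_norm _).trans
        ((χ.le_of_opNorm_le (mem_closedBall_zero_iff.1 hχ) _).trans (by linarith))
    have h1 := hval (unit A)
    rw [hΦ1, Complex.one_re] at h1
    have hextr : ∀ {p y z : ℝ}, p = a * y + b * z → y ≤ p → z ≤ p → p ≤ y ∧ p ≤ z := by
      intro p y z hp hy hz
      have hp' : a * p + b * p = p := by rw [← add_mul, hab, one_mul]
      have hy' := mul_le_mul_of_nonneg_left hy ha.le
      have hz' := mul_le_mul_of_nonneg_left hz hb.le
      exact ⟨le_of_mul_le_mul_left (by linarith) ha, le_of_mul_le_mul_left (by linarith) hb⟩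
    have h1' := hextr h1 (hle χ₁ hχ₁) (hle χ₂ hχ₂)
    have e1 : χ₁ (unit A) = 1 := hstate χ₁ hχ₁ h1'.1
    have e2 : χ₂ (unit A) = 1 := hstate χ₂ hχ₂ h1'.2
    have h2 := hval g
    rw [hΦg] at h2
    have m1 := hmax χ₁ hχ₁ e1
    have m2 := hmax χ₂ hχ₂ e2
    have g1 : (χ₁ g).re = (incl A g m).re := le_antisymm m1 (hextr h2 m1 m2).1
    have g2 : (χ₂ g).re = (incl A g m).re := le_antisymm m2 (hextr h2 m1 m2).2
    exact hφe (x₁ := StrongDual.toWeakDual χ₁) ⟨hχ₁, e1, g1⟩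
      (x₂ := StrongDual.toWeakDual χ₂) ⟨hχ₂, e2, g2⟩ ⟨a, b, ha, hb, hab, hΦ⟩
  obtain ⟨k, hk⟩ := exists_eq_evalFunctional hext hΦ1
  refine ⟨k, ?_, fun x => (hm x).trans ?_⟩
  · have : evalFunctional A k ∈ Set.extremePoints ℝ B := hk ▸ hext
    exact this
  · rw [← hΦg, hk, evalFunctional_apply]

/-- Each point of the Choquet boundary of a function algebra admits functions of norm at most one
that are almost one at the point and almost zero off a given neighbourhood. -/
theorem exists_almost_peak (hA : IsFunctionAlgebra A) {k : K} (hk : k ∈ choquetBoundary A)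
    {V : Set K} (hV : V ∈ 𝓝 k) {ε : ℝ} (hε : 0 < ε) :
    ∃ F : FunctionAlgebraSpace A, ‖F‖ ≤ 1 ∧ ‖incl A F k - 1‖ ≤ ε ∧
      ∀ x ∉ V, ‖incl A F x‖ ≤ ε := by
  obtain ⟨M, hM⟩ : ∃ M : ℝ, Real.exp (-M) ≤ ε :=
    ((Real.tendsto_exp_neg_atTop_nhds_zero.eventually_lt_const hε).exists).imp fun _ => le_of_lt
  -- Finitely many functions vanishing at `k` have no common zero off `V`.
  have hsep : ∀ j : K, ∃ g : FunctionAlgebraSpace A, incl A g k = 0 ∧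
      (j ∉ interior V → |M| + 1 < ‖incl A g j‖) := by
    intro j
    by_cases hj : j ∈ interior V
    · exact ⟨0, by simp, fun h => absurd hj h⟩
    have hne : j ≠ k := fun h => hj (h ▸ mem_interior_iff_mem_nhds.2 hV)
    obtain ⟨_, ⟨f, hf, rfl⟩, hfj⟩ := hA.separatesPoints hne
    let f' := ofMem f hf - f k • unit A
    have hf' : ∀ x, incl A f' x = f x - f k := fun x => by
      rw [map_sub, map_smul, ContinuousMap.sub_apply, ContinuousMap.smul_apply, incl_unit_apply,
        incl_ofMem, smul_eq_mul, mul_one]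
    have hfj' : ‖f j - f k‖ ≠ 0 := norm_ne_zero_iff.2 (sub_ne_zero.2 hfj)
    refine ⟨(((|M| + 2) / ‖f j - f k‖ : ℝ) : ℂ) • f', ?_, fun _ => ?_⟩
    · rw [map_smul, ContinuousMap.smul_apply, hf']; simp
    · rw [map_smul, ContinuousMap.smul_apply, hf', norm_smul, Complex.norm_real, norm_div,
        norm_norm, div_mul_cancel₀ _ hfj', Real.norm_eq_abs (|M| + 2),
        abs_of_nonneg (a := |M| + 2) (by positivity)]
      linarith
  choose g hg0 hg1 using hsep
  obtain ⟨t, ht⟩ := (isOpen_interior (s := V)).isClosed_compl.isCompact.elim_finite_subcover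
    (fun j => {x | |M| + 1 < ‖incl A (g j) x‖})
    (fun j => isOpen_lt continuous_const (by fun_prop))
    (fun j hj => mem_iUnion.2 ⟨j, hg1 j hj⟩)
  classical
  obtain ⟨f, hf, hfk⟩ := exists_re_ge_sum_sq hk rfl (t.image g)
    (fun x hx => by obtain ⟨j, _, rfl⟩ := Finset.mem_image.1 hx; exact hg0 j) hε
  rw [evalFunctional_apply] at hfk
  have hf0 : ∀ x, 0 ≤ (incl A f x).re := fun x =>
    (Finset.sum_nonneg fun _ _ => by positivity).trans (hf x)
  -- The rotation makes the value of the exponential at `k` positive.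
  let q : FunctionAlgebraSpace A := ((((incl A f k).im : ℝ) : ℂ) * Complex.I) • unit A - f
  have hq : ∀ x, incl A q x = ((incl A f k).im : ℂ) * Complex.I - incl A f x := fun x => by
    rw [map_sub, map_smul, ContinuousMap.sub_apply, ContinuousMap.smul_apply, incl_unit_apply,
      smul_eq_mul, mul_one]
  let F : FunctionAlgebraSpace A :=
    ofMem (NormedSpace.exp (incl A q)) (NormedSpace.exp_mem (R := ℂ) hA.isClosed (incl_mem q))
  have hF : ∀ x, incl A F x = Complex.exp (incl A q x) := fun x => by
    rw [Complex.exp_eq_exp_ℂ]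
    exact NormedSpace.map_exp (ContinuousMap.evalAlgHom ℂ ℂ x)
      (ContinuousEvalConst.continuous_eval_const x) (incl A q)
  have hFn : ∀ x, ‖incl A F x‖ = Real.exp (-(incl A f x).re) := fun x => by
    rw [hF, Complex.norm_exp, hq]; simp
  refine ⟨F, norm_le_of_forall_le zero_le_one fun x => ?_, ?_, fun x hx => ?_⟩
  · rw [hFn, Real.exp_le_one_iff]; linarith [hf0 x]
  · have h1 : incl A q k = ((-(incl A f k).re : ℝ) : ℂ) := by
      rw [hq]; apply Complex.ext <;> simp
    rw [hF, h1, ← Complex.ofReal_exp, ← Complex.ofReal_one, ← Complex.ofReal_sub,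
      Complex.norm_real, Real.norm_eq_abs, abs_le]
    have h2 := Real.add_one_le_exp (-(incl A f k).re)
    have h3 : Real.exp (-(incl A f k).re) ≤ 1 := Real.exp_le_one_iff.2 (by linarith [hf0 k])
    constructor <;> linarith
  · rw [hFn]
    refine le_trans (Real.exp_le_exp.2 (neg_le_neg ?_)) hM
    obtain ⟨j, hj, hjx⟩ := mem_iUnion₂.1 (ht fun h => hx (interior_subset h))
    have h4 : ‖incl A (g j) x‖ ^ 2 ≤ ∑ g ∈ t.image g, ‖incl A g x‖ ^ 2 :=
      Finset.single_le_sum (f := fun g => ‖incl A g x‖ ^ 2) (fun _ _ => by positivity)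
        (Finset.mem_image_of_mem g hj)
    have h5 : |M| + 1 < ‖incl A (g j) x‖ := hjx
    nlinarith [hf x, abs_nonneg M, le_abs_self M]

end ChoquetBoundary

/-! ### Approximate peak functions -/

section Peak

variable {K : Type*} [TopologicalSpace K] [CompactSpace K] {A : Subalgebra ℂ C(K, ℂ)}

open FunctionAlgebraSpace

/-- `f` is an approximate peak function at `s`: up to the error `ε`, it is one at `s` and zero off
`V`, and its values lie close to the interval `[0, 1]`, in the sense that `|z| + |1 - z|` is almost
one. The last condition makes `g * (1 - f) + f` almost a contraction whenever `g` is one. -/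
structure IsPeakingAt (s : K) (V : Set K) (ε : ℝ) (f : FunctionAlgebraSpace A) : Prop where
  norm_le : ‖f‖ ≤ 1
  apply_self : ‖1 - incl A f s‖ ≤ ε
  apply_off : ∀ x ∉ V, ‖incl A f x‖ ≤ ε
  norm_add_norm_le : ∀ x, ‖incl A f x‖ + ‖1 - incl A f x‖ ≤ 1 + ε

theorem IsPeakingAt.mono {s : K} {V V' : Set K} {ε ε' : ℝ} {f : FunctionAlgebraSpace A}
    (h : IsPeakingAt s V ε f) (hV : V ⊆ V') (hε : ε ≤ ε') : IsPeakingAt s V' ε' f where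
  norm_le := h.norm_le
  apply_self := h.apply_self.trans hε
  apply_off x hx := (h.apply_off x fun hx' => hx (hV hx')).trans hε
  norm_add_norm_le x := (h.norm_add_norm_le x).trans (by linarith)

theorem IsPeakingAt.convexCombination {s : K} {V : Set K} {ε : ℝ} {f g : FunctionAlgebraSpace A}
    (hf : IsPeakingAt s V ε f) (hg : IsPeakingAt s V ε g) {a b : ℝ} (ha : 0 ≤ a) (hb : 0 ≤ b)
    (hab : a + b = 1) : IsPeakingAt s V ε ((a : ℂ) • f + (b : ℂ) • g) := by
  have hval : ∀ x, incl A ((a : ℂ) • f + (b : ℂ) • g) x = a * incl A f x + b * incl A g x :=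
    fun x => by rw [map_add, map_smul, map_smul]; rfl
  have hn : ∀ z w : ℂ, ‖a * z + b * w‖ ≤ a * ‖z‖ + b * ‖w‖ := fun z w => by
    refine (norm_add_le _ _).trans_eq ?_
    rw [norm_mul, norm_mul, Complex.norm_of_nonneg ha, Complex.norm_of_nonneg hb]
  have hsub : ∀ x, (1 : ℂ) - (a * incl A f x + b * incl A g x)
      = a * (1 - incl A f x) + b * (1 - incl A g x) := fun x => by
    have : (a : ℂ) + b = 1 := by exact_mod_cast hab
    linear_combination -this
  have hc : ∀ {p y z : ℝ}, y ≤ p → z ≤ p → a * y + b * z ≤ p := fun {p y z} hy hz => by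
    have := mul_le_mul_of_nonneg_left hy ha
    have := mul_le_mul_of_nonneg_left hz hb
    have : a * p + b * p = p := by rw [← add_mul, hab, one_mul]
    linarith
  refine ⟨norm_le_of_forall_le zero_le_one fun x => ?_, ?_, fun x hx => ?_, fun x => ?_⟩
  · rw [hval]
    exact (hn _ _).trans (hc ((norm_apply_le f x).trans hf.norm_le)
      ((norm_apply_le g x).trans hg.norm_le))
  · rw [hval, hsub]
    exact (hn _ _).trans (hc hf.apply_self hg.apply_self)
  · rw [hval]
    exact (hn _ _).trans (hc (hf.apply_off x hx) (hg.apply_off x hx))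
  · rw [hval, hsub]
    refine (add_le_add (hn _ _) (hn _ _)).trans ?_
    linarith [hc (hf.norm_add_norm_le x) (hg.norm_add_norm_le x)]

/-- Approximate peak functions exist at each point of the Choquet boundary. At each point of `K`,
all but one of the averaged functions are close to one or to zero, as the neighbourhoods off which
they are small are nested. -/
theorem exists_isPeakingAt (hA : IsFunctionAlgebra A) {k : K} (hk : k ∈ choquetBoundary A)
    {V : Set K} (hV : V ∈ 𝓝 k) {ε : ℝ} (hε : 0 < ε) :
    ∃ f : FunctionAlgebraSpace A, IsPeakingAt k V ε f := by
  obtain ⟨δ, hδ0, hδ⟩ : ∃ δ : ℝ, 0 < δ ∧ 2 * δ ≤ ε / 2 := ⟨ε / 4, by positivity, by linarith⟩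
  -- `g` is a sum of `N` almost peak functions, all of which are almost one on `W`.
  have hind : ∀ N : ℕ, ∃ (g : FunctionAlgebraSpace A) (W : Set K), W ∈ 𝓝 k ∧ W ⊆ V ∧
      (∀ x, ‖incl A g x‖ ≤ N) ∧ (∀ x ∉ V, ‖incl A g x‖ ≤ N * δ) ∧
      (∀ x ∈ W, ‖N - incl A g x‖ ≤ N * δ) ∧
      ∀ x, ‖incl A g x‖ + ‖N - incl A g x‖ ≤ N + 2 + 2 * (N * δ) := by
    intro N
    induction N with
    | zero => exact ⟨0, V, hV, Subset.rfl, by simp, by simp, by simp, by simp⟩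
    | succ N ih =>
      obtain ⟨g, W, hW, hWV, hg1, hg2, hg3, hg4⟩ := ih
      obtain ⟨F, hF1, hF2, hF3⟩ := exists_almost_peak hA hk hW (half_pos hδ0)
      have hF : ∀ x, ‖incl A F x‖ ≤ 1 := fun x => (norm_apply_le F x).trans hF1
      have hF' : ∀ x, ‖1 - incl A F x‖ ≤ 1 + ‖incl A F x‖ := fun x =>
        (norm_sub_le _ _).trans (by simp)
      have hval : ∀ x, incl A (g + F) x = incl A g x + incl A F x := fun x => by
        rw [map_add]; rfl
      have hsub : ∀ x, ((N + 1 : ℕ) : ℂ) - (incl A g x + incl A F x)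
          = (N - incl A g x) + (1 - incl A F x) := fun x => by push_cast; ring
      refine ⟨g + F, W ∩ {x | ‖1 - incl A F x‖ < δ}, inter_mem hW ?_,
        inter_subset_left.trans hWV, fun x => ?_, fun x hx => ?_, fun x hx => ?_, fun x => ?_⟩
      · refine (isOpen_lt (by fun_prop) continuous_const).mem_nhds ?_
        rw [norm_sub_rev] at hF2
        exact hF2.trans_lt (half_lt_self hδ0)
      · rw [hval]
        push_cast
        exact (norm_add_le _ _).trans (add_le_add (hg1 x) (hF x))
      · rw [hval]
        push_cast
        refine (norm_add_le _ _).trans ?_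
        linarith [hg2 x hx, hF3 x fun h => hx (hWV h)]
      · rw [hval, hsub]
        push_cast
        have hx2 : ‖1 - incl A F x‖ < δ := hx.2
        refine (norm_add_le _ _).trans ?_
        linarith [hg3 x hx.1]
      · rw [hval, hsub]
        have h1 := norm_add_le (incl A g x) (incl A F x)
        have h2 := norm_add_le (N - incl A g x) (1 - incl A F x)
        push_cast
        by_cases hx : x ∈ W
        · have : 0 ≤ N * δ := by positivity
          linarith [hg3 x hx, hg1 x, hF x, hF' x]
        · linarith [hg4 x, hF3 x hx, hF' x]
  obtain ⟨N, hN⟩ := exists_nat_gt (4 / ε)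
  have hN0 : (0 : ℝ) < N := (by positivity : 0 < 4 / ε).trans hN
  have hNε : 4 ≤ N * ε := by
    rw [div_lt_iff₀ hε] at hN; exact hN.le
  have hNC : (N : ℂ) ≠ 0 := by exact_mod_cast hN0.ne'
  have hNδ : N * δ ≤ N * ε := mul_le_mul_of_nonneg_left (by linarith) hN0.le
  have hNδ2 : 2 * (N * δ) ≤ N * ε / 2 := by
    have := mul_le_mul_of_nonneg_left hδ hN0.le
    linarith
  obtain ⟨g, W, hW, hWV, hg1, hg2, hg3, hg4⟩ := hind N
  have hval : ∀ x, incl A ((N : ℂ)⁻¹ • g) x = (N : ℂ)⁻¹ * incl A g x := fun x => by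
    rw [map_smul]; rfl
  have hsub : ∀ x, 1 - (N : ℂ)⁻¹ * incl A g x = (N : ℂ)⁻¹ * (N - incl A g x) := fun x => by
    field_simp
  have hn : ∀ z : ℂ, ‖(N : ℂ)⁻¹ * z‖ = (N : ℝ)⁻¹ * ‖z‖ := fun z => by
    rw [norm_mul, norm_inv, Complex.norm_natCast]
  have hinv : ∀ {r c : ℝ}, r ≤ N * c → (N : ℝ)⁻¹ * r ≤ c := fun {r c} h =>
    (inv_mul_le_iff₀ hN0).2 h
  refine ⟨(N : ℂ)⁻¹ • g, norm_le_of_forall_le zero_le_one fun x => ?_, ?_, fun x hx => ?_,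
    fun x => ?_⟩
  · rw [hval, hn]
    exact hinv (by linarith [hg1 x])
  · rw [hval, hsub, hn]
    exact hinv ((hg3 k (mem_of_mem_nhds hW)).trans hNδ)
  · rw [hval, hn]
    exact hinv ((hg2 x hx).trans hNδ)
  · rw [hval, hsub, hn, hn, ← mul_add]
    exact hinv (by linarith [hg4 x])

/-- A functional can be bounded below on functions peaking at arbitrarily small neighbourhoods of
`s` only for few points `s`: sums of functions peaking at distinct points are bounded. -/
theorem card_mul_le_of_forall_isPeakingAt [T2Space K] (S : Finset K)
    (y : StrongDual ℂ (FunctionAlgebraSpace A)) {δ : ℝ}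
    (h : ∀ s ∈ S, ∀ V ∈ 𝓝 s, ∀ ε > 0, ∃ f, IsPeakingAt s V ε f ∧ δ ≤ ‖y f‖) :
    S.card * δ ≤ 2 * ‖y‖ := by
  obtain ⟨U, hU, hdisj⟩ := S.finite_toSet.t2_separation
  have hε : (0 : ℝ) < ((S.card : ℝ) + 1)⁻¹ := by positivity
  have h' : ∀ s, ∃ f : FunctionAlgebraSpace A, s ∈ S →
      IsPeakingAt s (U s) ((S.card : ℝ) + 1)⁻¹ f ∧ δ ≤ ‖y f‖ := by
    intro s
    by_cases hs : s ∈ S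
    · obtain ⟨f, hf⟩ := h s hs (U s) ((hU s).2.mem_nhds (hU s).1) _ hε
      exact ⟨f, fun _ => hf⟩
    · exact ⟨0, fun h => absurd h hs⟩
  choose f hf using h'
  choose c hc hcf using fun s => RCLike.exists_norm_eq_mul_self (y (f s))
  have hval : ∀ x, ‖incl A (∑ s ∈ S, c s • f s) x‖ ≤ ∑ s ∈ S, ‖incl A (f s) x‖ := fun x => by
    rw [map_sum, ContinuousMap.sum_apply]
    refine (norm_sum_le _ _).trans (Finset.sum_le_sum fun s _ => ?_)
    rw [map_smul, ContinuousMap.smul_apply, norm_smul, hc, one_mul]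
  have hsmall : ∀ (T : Finset K) (x : K), T ⊆ S → (∀ s ∈ T, x ∉ U s) →
      ∑ s ∈ T, ‖incl A (f s) x‖ ≤ 1 := fun T x hTS hT => by
    refine (Finset.sum_le_sum fun s hs => (hf s (hTS hs)).1.apply_off x (hT s hs)).trans ?_
    rw [Finset.sum_const, nsmul_eq_mul, ← div_eq_mul_inv, div_le_one (by positivity)]
    have : (T.card : ℝ) ≤ S.card := by exact_mod_cast Finset.card_le_card hTS
    linarith
  have hnorm : ‖∑ s ∈ S, c s • f s‖ ≤ 2 := by
    classical
    refine norm_le_of_forall_le zero_le_two fun x => (hval x).trans ?_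
    by_cases hx : ∃ s ∈ S, x ∈ U s
    · obtain ⟨s, hs, hxs⟩ := hx
      rw [← Finset.add_sum_erase S _ hs]
      have h1 : ‖incl A (f s) x‖ ≤ 1 := (norm_apply_le _ x).trans (hf s hs).1.norm_le
      have h2 := hsmall (S.erase s) x (Finset.erase_subset _ _) fun t ht hxt =>
        (Set.disjoint_left.1 (hdisj (Finset.mem_of_mem_erase ht) hs (Finset.ne_of_mem_erase ht))
          hxt) hxs
      linarith
    · push Not at hx
      exact (hsmall S x Finset.Subset.rfl hx).trans one_le_two
  have hy : y (∑ s ∈ S, c s • f s) = ((∑ s ∈ S, ‖y (f s)‖ : ℝ) : ℂ) := by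
    rw [map_sum, Complex.ofReal_sum]
    exact Finset.sum_congr rfl fun s _ => by
      rw [map_smul, smul_eq_mul]; exact (hcf s).symm
  calc S.card * δ = ∑ s ∈ S, δ := by rw [Finset.sum_const, nsmul_eq_mul]
    _ ≤ ∑ s ∈ S, ‖y (f s)‖ := Finset.sum_le_sum fun s hs => (hf s hs).2
    _ = ‖y (∑ s ∈ S, c s • f s)‖ := by
      rw [hy, Complex.norm_real, Real.norm_of_nonneg (by positivity)]
    _ ≤ ‖y‖ * 2 := (y.le_opNorm _).trans (by gcongr)
    _ = 2 * ‖y‖ := mul_comm _ _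

/-- A relatively open nonempty piece of the Choquet boundary is uncountable if the Choquet boundary
has no isolated points. Generically, a function of `A` near one that peaks in the piece does not
attain the maximum of its real part at any of countably many given points. -/
theorem exists_mem_choquetBoundary_notMem_countable [T2Space K] [Nonempty K]
    (hA : IsFunctionAlgebra A) (hiso : Preperfect (choquetBoundary A)) {O : Set K} (hO : IsOpen O)
    (hne : (O ∩ choquetBoundary A).Nonempty) {Z : Set K} (hZ : Z.Countable) :
    ∃ s ∈ O ∩ choquetBoundary A, s ∉ Z := by
  have hcomplete : CompleteSpace (FunctionAlgebraSpace A) := by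
    have : IsClosed (Subalgebra.toSubmodule A : Set C(K, ℂ)) := hA.isClosed
    exact this.completeSpace_coe
  let D : K → Set (FunctionAlgebraSpace A) := fun z => {g | ∃ x, (incl A g z).re < (incl A g x).re}
  have hcont : ∀ x, Continuous fun g : FunctionAlgebraSpace A => (incl A g x).re := fun x =>
    Complex.continuous_re.comp (evalFunctional A x).continuous
  have hDo : ∀ z ∈ Z, IsOpen (D z) := fun z _ => by
    have : D z = ⋃ x, {g | (incl A g z).re < (incl A g x).re} := by
      ext g; simp [D]
    rw [this]
    exact isOpen_iUnion fun x => isOpen_lt (hcont z) (hcont x)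
  have hDd : ∀ z ∈ Z, Dense (D z) := fun z _ => by
    refine Metric.dense_iff.2 fun g r hr => ?_
    obtain ⟨p, hp, hpmax⟩ := exists_mem_choquetBoundary_isMax_re g
    obtain ⟨c, hc0, hcr⟩ : ∃ c, 0 < c ∧ c < r := exists_between hr
    -- A point of the boundary other than `z` at which `Re g` almost attains its maximum.
    obtain ⟨t, ⟨htU, ht⟩, htz⟩ : ∃ t ∈ {x | (incl A g p).re - c / 4 < (incl A g x).re} ∩
        choquetBoundary A, t ≠ z := by
      by_cases hpz : p = z
      · obtain ⟨t, ht, hne⟩ := preperfect_iff_nhds.1 hiso p hp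
          {x | (incl A g p).re - c / 4 < (incl A g x).re}
          ((isOpen_lt continuous_const (by fun_prop)).mem_nhds
            (show (incl A g p).re - c / 4 < (incl A g p).re by linarith))
        exact ⟨t, ht, hpz ▸ hne⟩
      · exact ⟨p, ⟨show (incl A g p).re - c / 4 < (incl A g p).re by linarith, hp⟩, hpz⟩
    obtain ⟨F, hF1, hF2, hF3⟩ := exists_almost_peak hA ht
      (isOpen_compl_singleton.mem_nhds htz : {z}ᶜ ∈ 𝓝 t) (by norm_num : (0 : ℝ) < 1 / 4)
    refine ⟨g + (c : ℂ) • F, ?_, t, ?_⟩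
    · rw [mem_ball_iff_norm, add_sub_cancel_left, norm_smul, Complex.norm_of_nonneg hc0.le]
      nlinarith
    · have hval : ∀ x, (incl A (g + (c : ℂ) • F) x).re = (incl A g x).re + c * (incl A F x).re :=
        fun x => by
          rw [map_add, map_smul, ← Complex.re_ofReal_mul, ← Complex.add_re]; rfl
      have h1 : (incl A F z).re ≤ 1 / 4 := (Complex.re_le_norm _).trans (hF3 z (by simp))
      have h2 := (abs_le.1 ((Complex.abs_re_le_norm _).trans hF2)).1
      rw [Complex.sub_re, Complex.one_re] at h2
      have h3 := hpmax z
      have h4 : (incl A g p).re - c / 4 < (incl A g t).re := htU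
      rw [hval, hval]
      nlinarith
  obtain ⟨k, hkO, hk⟩ := hne
  obtain ⟨F, -, hF2, hF3⟩ := exists_almost_peak hA hk (hO.mem_nhds hkO)
    (by norm_num : (0 : ℝ) < 1 / 4)
  obtain ⟨G, hGD, hGF⟩ := (dense_biInter_of_isOpen hDo hZ hDd).exists_dist_lt F
    (by norm_num : (0 : ℝ) < 1 / 8)
  rw [mem_iInter₂] at hGD
  obtain ⟨s, hs, hmax⟩ := exists_mem_choquetBoundary_isMax_re G
  have hclose : ∀ x, |(incl A F x).re - (incl A G x).re| ≤ 1 / 8 := fun x => by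
    rw [← Complex.sub_re, ← ContinuousMap.sub_apply, ← map_sub]
    rw [dist_eq_norm] at hGF
    exact (Complex.abs_re_le_norm _).trans ((norm_apply_le _ x).trans hGF.le)
  refine ⟨s, ⟨?_, hs⟩, fun hsZ => ?_⟩
  · by_contra hsO
    have h1 := (Complex.re_le_norm _).trans (hF3 s hsO)
    have h2 := (abs_le.1 ((Complex.abs_re_le_norm _).trans hF2)).1
    rw [Complex.sub_re, Complex.one_re] at h2
    linarith [(abs_le.1 (hclose s)).1, (abs_le.1 (hclose k)).2, hmax k]
  · obtain ⟨x, hx⟩ := hGD s hsZ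
    linarith [hmax x]

end Peak

/-! ### Operators small on peak functions satisfy the Daugavet equation -/

section Daugavet

variable {K : Type*} [TopologicalSpace K] [CompactSpace K] {A : Subalgebra ℂ C(K, ℂ)}

open FunctionAlgebraSpace

/-- The Daugavet equation holds if `T f` is small at `s` for functions `f` peaking at `s`, for some
`s` in each relatively open piece of the Choquet boundary. The witness for `‖Id + T‖` is obtained
from a function `g` almost attaining `‖T‖` at `s`, by changing its value at `s` to one. -/
theorem norm_id_add_eq_of_small_at_peak [Nonempty K]
    (T : FunctionAlgebraSpace A →L[ℂ] FunctionAlgebraSpace A)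
    (hT : ∀ η > 0, ∀ O : Set K, IsOpen O → (O ∩ choquetBoundary A).Nonempty →
      ∃ s ∈ O ∩ choquetBoundary A, ∀ V ∈ 𝓝 s, ∀ ε > 0,
        ∃ f, IsPeakingAt s V ε f ∧ ‖incl A (T f) s‖ ≤ η) :
    ‖ContinuousLinearMap.id ℂ (FunctionAlgebraSpace A) + T‖ = 1 + ‖T‖ := by
  set N := ‖ContinuousLinearMap.id ℂ (FunctionAlgebraSpace A) + T‖ with hN
  refine le_antisymm ((norm_add_le _ _).trans
    (add_le_add_left ContinuousLinearMap.norm_id_le _)) ?_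
  have key : ∀ η : ℝ, 0 < η → 1 + ‖T‖ ≤ N * (1 + η) + η * (5 + 2 * ‖T‖) := by
    intro η hη
    obtain ⟨g₀, hg₀, hTg₀⟩ := T.exists_lt_apply_of_lt_opNorm (r := ‖T‖ - η) (by linarith)
    obtain ⟨x₀, hx₀⟩ : ∃ x, ‖T‖ - η < ‖incl A (T g₀) x‖ := by
      by_contra! h
      obtain ⟨z⟩ := ‹Nonempty K›
      exact hTg₀.not_ge (norm_le_of_forall_le ((norm_nonneg _).trans (h z)) h)
    obtain ⟨c, hc, hcx⟩ := RCLike.exists_norm_eq_mul_self (incl A (T g₀) x₀)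
    have hgn : ‖c • g₀‖ ≤ 1 := by rw [norm_smul, hc, one_mul]; exact hg₀.le
    have hgx : ‖T‖ - η < (incl A (T (c • g₀)) x₀).re := by
      rw [map_smul, map_smul, ContinuousMap.smul_apply, smul_eq_mul, ← hcx]
      exact hx₀
    generalize c • g₀ = g at hgn hgx
    obtain ⟨k, hk, hkmax⟩ := exists_mem_choquetBoundary_isMax_re (T g)
    obtain ⟨s, ⟨hsO, -⟩, hs⟩ := hT η hη {x | ‖T‖ - η < (incl A (T g) x).re}
      (isOpen_lt continuous_const (by fun_prop)) ⟨k, hgx.trans_le (hkmax x₀), hk⟩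
    obtain ⟨f, hf, hTf⟩ := hs {x | ‖incl A g x - incl A g s‖ < η}
      ((isOpen_lt (by fun_prop) continuous_const).mem_nhds (by simpa using hη)) η hη
    have hg : ∀ x, ‖incl A g x‖ ≤ 1 := fun x => (norm_apply_le g x).trans hgn
    -- `h = (g - g s) * f` is small by the continuity of `g`.
    let h : FunctionAlgebraSpace A :=
      ofMem (incl A g * incl A f) (A.mul_mem (incl_mem g) (incl_mem f)) - incl A g s • f
    have hh : ∀ x, incl A h x = (incl A g x - incl A g s) * incl A f x := fun x => by
      rw [map_sub, map_smul, incl_ofMem, sub_mul]; rfl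
    have hhn : ‖h‖ ≤ 2 * η := norm_le_of_forall_le (by positivity) fun x => by
      rw [hh, norm_mul]
      by_cases hx : ‖incl A g x - incl A g s‖ < η
      · have := (norm_apply_le f x).trans hf.norm_le
        nlinarith [norm_nonneg (incl A f x), norm_nonneg (incl A g x - incl A g s)]
      · have h1 := hf.apply_off x hx
        have h2 : ‖incl A g x - incl A g s‖ ≤ 2 :=
          (norm_sub_le _ _).trans (by linarith [hg x, hg s])
        exact mul_le_mul h2 h1 (norm_nonneg _) zero_le_two
    let G : FunctionAlgebraSpace A := g - (h + incl A g s • f) + f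
    have hG : ∀ x, incl A G x = incl A g x * (1 - incl A f x) + incl A f x := fun x => by
      have : incl A G x = incl A g x - (incl A h x + incl A g s * incl A f x) + incl A f x := by
        simp only [G, map_add, map_sub, map_smul]; rfl
      rw [this, hh]; ring
    have hGn : ‖G‖ ≤ 1 + η := norm_le_of_forall_le (by positivity) fun x => by
      rw [hG]
      refine (norm_add_le _ _).trans ?_
      rw [norm_mul]
      have := mul_le_mul_of_nonneg_right (hg x) (norm_nonneg (1 - incl A f x))
      linarith [hf.norm_add_norm_le x]
    have hval : incl A (G + T G) s = incl A f s + incl A g s * (1 - incl A f s)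
        + incl A (T g) s + (1 - incl A g s) * incl A (T f) s - incl A (T h) s := by
      have : incl A (T G) s = incl A (T g) s
          - (incl A (T h) s + incl A g s * incl A (T f) s) + incl A (T f) s := by
        simp only [G, map_add, map_sub, map_smul]; rfl
      rw [map_add, ContinuousMap.add_apply, hG, this]; ring
    have hle : (incl A (G + T G) s).re ≤ N * (1 + η) := by
      refine (Complex.re_le_norm _).trans ((norm_apply_le _ s).trans ?_)
      exact (ContinuousLinearMap.le_opNorm (ContinuousLinearMap.id ℂ _ + T) G).trans
        (mul_le_mul_of_nonneg_left hGn (norm_nonneg _))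
    have b1 : 1 - η ≤ (incl A f s).re := by
      have := (Complex.re_le_norm _).trans hf.apply_self
      rw [Complex.sub_re, Complex.one_re] at this
      linarith
    have b2 : -η ≤ (incl A g s * (1 - incl A f s)).re := by
      refine (abs_le.1 ((Complex.abs_re_le_norm _).trans ?_)).1
      rw [norm_mul]
      nlinarith [hg s, hf.apply_self, norm_nonneg (1 - incl A f s)]
    have b3 : -(2 * η) ≤ ((1 - incl A g s) * incl A (T f) s).re := by
      refine (abs_le.1 ((Complex.abs_re_le_norm _).trans ?_)).1
      rw [norm_mul]
      have : ‖1 - incl A g s‖ ≤ 2 := (norm_sub_le _ _).trans (by rw [norm_one]; linarith [hg s])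
      exact mul_le_mul this hTf (norm_nonneg _) zero_le_two
    have b4 : (incl A (T h) s).re ≤ ‖T‖ * (2 * η) :=
      (Complex.re_le_norm _).trans ((norm_apply_le _ s).trans ((T.le_opNorm h).trans
        (mul_le_mul_of_nonneg_left hhn (norm_nonneg _))))
    have b5 : ‖T‖ - η < (incl A (T g) s).re := hsO
    rw [hval] at hle
    simp only [Complex.add_re, Complex.sub_re] at hle
    linarith
  have hlim : Tendsto (fun η : ℝ => N * (1 + η) + η * (5 + 2 * ‖T‖)) (𝓝[>] 0) (𝓝 N) := by
    have : Tendsto (fun η : ℝ => N * (1 + η) + η * (5 + 2 * ‖T‖)) (𝓝 0)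
        (𝓝 (N * (1 + 0) + 0 * (5 + 2 * ‖T‖))) := by
      apply Continuous.tendsto; fun_prop
    simpa using this.mono_left nhdsWithin_le_nhds
  exact ge_of_tendsto hlim (eventually_mem_nhdsWithin.mono fun η hη => key η hη)

/-! ### Weakly compact operators -/

/-- If a weakly compact operator does not make functions peaking at `s` small at `s`, a weak
cluster point of their images is nonzero at `s`, hence near `s`. -/
theorem exists_nhds_large_of_isWeaklyCompactOperator (hA : IsFunctionAlgebra A)
    {T : FunctionAlgebraSpace A →L[ℂ] FunctionAlgebraSpace A} (hT : IsWeaklyCompactOperator T)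
    {s : K} (hs : s ∈ choquetBoundary A) {η : ℝ} (hη : 0 < η) {V₀ : Set K} (hV₀ : V₀ ∈ 𝓝 s)
    {ε₀ : ℝ} (hε₀ : 0 < ε₀) (hlarge : ∀ f, IsPeakingAt s V₀ ε₀ f → η < ‖incl A (T f) s‖) :
    ∃ U : Set K, IsOpen U ∧ s ∈ U ∧ ∀ t ∈ U, ∀ V ∈ 𝓝 s, ∀ ε > 0,
      ∃ f, IsPeakingAt s V ε f ∧ η / 2 ≤ ‖incl A (T f) t‖ := by
  have hex : ∀ i : (TopologicalSpace.OpenNhdsOf s)ᵒᵈ × ℕ, ∃ f : FunctionAlgebraSpace A,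
      IsPeakingAt s ((OrderDual.ofDual i.1 : TopologicalSpace.OpenNhdsOf s) : Set K)
        (1 / ((i.2 : ℝ) + 1)) f := fun i =>
    exists_isPeakingAt hA hs
      ((OrderDual.ofDual i.1).isOpen.mem_nhds (OrderDual.ofDual i.1).mem) (by positivity)
  choose F hF using hex
  have hev : ∀ V ∈ 𝓝 s, ∀ ε > 0, ∀ᶠ i in atTop, IsPeakingAt s V ε (F i) := by
    intro V hV ε hε
    obtain ⟨U, -, hUV⟩ := TopologicalSpace.OpenNhdsOf.basis_nhds.mem_iff.1 hV
    obtain ⟨n, hn⟩ := exists_nat_one_div_lt hε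
    filter_upwards [eventually_ge_atTop (OrderDual.toDual U, n)] with i hi
    have h1 : ((OrderDual.ofDual i.1 : TopologicalSpace.OpenNhdsOf s) : Set K) ⊆ U :=
      OrderDual.ofDual_le_ofDual.2 hi.1
    refine (hF i).mono (h1.trans hUV) (le_trans ?_ hn.le)
    have : (n : ℝ) ≤ i.2 := by exact_mod_cast hi.2
    gcongr
  obtain ⟨h, -, hh⟩ := hT.exists_mapClusterPt (f := atTop)
    (u := fun i => toWeakSpace ℂ (FunctionAlgebraSpace A) (T (F i)))
    (le_principal_iff.2 (mem_map.2 (Eventually.of_forall fun i => subset_closure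
      (mem_image_of_mem _ (mem_image_of_mem _ (mem_closedBall_zero_iff.2 (hF i).norm_le))))))
  let H : FunctionAlgebraSpace A := (toWeakSpace ℂ (FunctionAlgebraSpace A)).symm h
  have heval : ∀ t : K, Continuous fun v : WeakSpace ℂ (FunctionAlgebraSpace A) =>
      ‖incl A ((toWeakSpace ℂ (FunctionAlgebraSpace A)).symm v) t‖ := fun t =>
    (WeakBilin.eval_continuous (topDualPairing ℂ (FunctionAlgebraSpace A)).flip
      (evalFunctional A t)).norm
  have hfreq : ∀ t : K, ∀ O : Set ℝ, IsOpen O → ‖incl A H t‖ ∈ O →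
      ∃ᶠ i in atTop, ‖incl A (T (F i)) t‖ ∈ O := fun t O hO hHO =>
    hh.frequently ((heval t).continuousAt.eventually (hO.mem_nhds hHO))
  have hHs : η ≤ ‖incl A H s‖ := by
    by_contra! hlt
    obtain ⟨i, hi1, hi2⟩ := ((hfreq s (Iio η) isOpen_Iio hlt).and_eventually
      (hev V₀ hV₀ ε₀ hε₀)).exists
    exact (hlarge _ hi2).not_ge (le_of_lt hi1)
  refine ⟨{t | η / 2 < ‖incl A H t‖}, isOpen_lt continuous_const (by fun_prop),
    (half_lt_self hη).trans_le hHs, fun t ht V hV ε hε => ?_⟩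
  obtain ⟨i, hi1, hi2⟩ := ((hfreq t (Ioi (η / 2)) isOpen_Ioi ht).and_eventually
    (hev V hV ε hε)).exists
  exact ⟨F i, hi2, le_of_lt hi1⟩

/-- A weakly compact operator is small at `s` on functions peaking at `s`, for some `s` in each
relatively open piece of the Choquet boundary. -/
theorem small_at_peak_of_isWeaklyCompactOperator [T2Space K] [Nonempty K]
    (hA : IsFunctionAlgebra A) (hiso : Preperfect (choquetBoundary A))
    {T : FunctionAlgebraSpace A →L[ℂ] FunctionAlgebraSpace A} (hT : IsWeaklyCompactOperator T)
    {η : ℝ} (hη : 0 < η) {O : Set K} (hO : IsOpen O) (hne : (O ∩ choquetBoundary A).Nonempty) :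
    ∃ s ∈ O ∩ choquetBoundary A, ∀ V ∈ 𝓝 s, ∀ ε > 0,
      ∃ f, IsPeakingAt s V ε f ∧ ‖incl A (T f) s‖ ≤ η := by
  by_contra! hcon
  -- Otherwise, at suitable points `t`, the functional `f ↦ T f t` is large on functions peaking at
  -- any given number of points.
  have hind : ∀ n : ℕ, ∃ (S : Finset K) (U : Set K), S.card = n ∧ IsOpen U ∧ U ⊆ O ∧
      (U ∩ choquetBoundary A).Nonempty ∧ ∀ t ∈ U, ∀ s ∈ S, ∀ V ∈ 𝓝 s, ∀ ε > 0,
        ∃ f, IsPeakingAt s V ε f ∧ η / 2 ≤ ‖incl A (T f) t‖ := by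
    intro n
    induction n with
    | zero => exact ⟨∅, O, rfl, hO, Subset.rfl, hne, by simp⟩
    | succ n ih =>
      obtain ⟨S, U, hS, hU, hUO, hUne, hlarge⟩ := ih
      obtain ⟨s, ⟨hsU, hs⟩, hsS⟩ :=
        exists_mem_choquetBoundary_notMem_countable hA hiso hU hUne S.countable_toSet
      obtain ⟨V₀, hV₀, ε₀, hε₀, hbad⟩ := hcon s ⟨hUO hsU, hs⟩
      obtain ⟨W, hW, hsW, hWlarge⟩ :=
        exists_nhds_large_of_isWeaklyCompactOperator hA hT hs hη hV₀ hε₀ hbad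
      classical
      refine ⟨insert s S, U ∩ W, ?_, hU.inter hW, inter_subset_left.trans hUO,
        ⟨s, ⟨hsU, hsW⟩, hs⟩, fun t ht r hr => ?_⟩
      · rw [Finset.card_insert_of_notMem (by simpa using hsS), hS]
      · rcases Finset.mem_insert.1 hr with rfl | hr
        · exact hWlarge t ht.2
        · exact hlarge t ht.1 r hr
  obtain ⟨n, hn⟩ := exists_nat_gt (4 * ‖T‖ / η)
  obtain ⟨S, U, hS, -, -, ⟨t, htU, -⟩, hlarge⟩ := hind n
  have h1 := card_mul_le_of_forall_isPeakingAt S ((evalFunctional A t).comp T) (hlarge t htU)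
  have h2 : ‖(evalFunctional A t).comp T‖ ≤ ‖T‖ :=
    (ContinuousLinearMap.opNorm_comp_le _ _).trans
      (mul_le_of_le_one_left (norm_nonneg _) (norm_evalFunctional_le t))
  rw [hS] at h1
  rw [div_lt_iff₀ hη] at hn
  linarith

/-! ### Operators that factor through a subspace of the null sequences -/

theorem ZeroAtInftyContinuousMap.norm_le_of_forall_le {x : C₀(ℕ, ℂ)} {C : ℝ} (hC : 0 ≤ C)
    (h : ∀ m, ‖x m‖ ≤ C) : ‖x‖ ≤ C := by
  rw [← ZeroAtInftyContinuousMap.norm_toBCF_eq_norm]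
  exact (BoundedContinuousFunction.norm_le hC).2 h

theorem ZeroAtInftyContinuousMap.norm_apply_le (x : C₀(ℕ, ℂ)) (m : ℕ) : ‖x m‖ ≤ ‖x‖ := by
  rw [← ZeroAtInftyContinuousMap.norm_toBCF_eq_norm]
  exact x.toBCF.norm_coe_le_norm m

/-- For a sequence of functionals, outside a countable set of points `s` each of them is small on
all functions peaking at a small enough neighbourhood of `s`. -/
theorem countable_setOf_large_at_peak [T2Space K] (y : ℕ → StrongDual ℂ (FunctionAlgebraSpace A)) :
    {s : K | ∃ m, ∃ δ > 0, ∀ V ∈ 𝓝 s, ∀ ε > 0,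
      ∃ f, IsPeakingAt s V ε f ∧ δ ≤ ‖y m f‖}.Countable := by
  let Z : ℕ → ℕ → Set K := fun m n => {s | ∀ V ∈ 𝓝 s, ∀ ε > 0,
    ∃ f, IsPeakingAt s V ε f ∧ 1 / ((n : ℝ) + 1) ≤ ‖y m f‖}
  have hZ : ∀ m n, (Z m n).Finite := by
    intro m n
    by_contra hinf
    obtain ⟨k, hk⟩ := exists_nat_gt (2 * ‖y m‖ * ((n : ℝ) + 1))
    obtain ⟨S, hSZ, hS⟩ := Set.Infinite.exists_subset_card_eq hinf k
    have := card_mul_le_of_forall_isPeakingAt S (y m) fun s hs => hSZ hs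
    rw [hS, mul_one_div, div_le_iff₀ (by positivity)] at this
    linarith
  refine (countable_iUnion fun m => countable_iUnion fun n => (hZ m n).countable).mono ?_
  rintro s ⟨m, δ, hδ, h⟩
  obtain ⟨n, hn⟩ := exists_nat_one_div_lt hδ
  refine mem_iUnion₂.2 ⟨m, n, fun V hV ε hε => ?_⟩
  obtain ⟨f, hf, hfδ⟩ := h V hV ε hε
  exact ⟨f, hf, hn.le.trans hfδ⟩

/-- If all coordinates of an operator into the null sequences become small on functions peaking at
`s`, then the operator itself is small on some of them, by averaging over a gliding hump. -/
theorem exists_isPeakingAt_norm_le (hA : IsFunctionAlgebra A)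
    (T : FunctionAlgebraSpace A →L[ℂ] C₀(ℕ, ℂ)) {s : K} (hs : s ∈ choquetBoundary A)
    (hsmall : ∀ m, ∀ δ > 0, ∃ V ∈ 𝓝 s, ∃ ε > 0, ∀ f, IsPeakingAt s V ε f → ‖T f m‖ < δ)
    {V : Set K} (hV : V ∈ 𝓝 s) {ε : ℝ} (hε : 0 < ε) {κ : ℝ} (hκ : 0 < κ) :
    ∃ f, IsPeakingAt s V ε f ∧ ‖T f‖ ≤ κ := by
  have hfin : ∀ M : ℕ, ∀ δ > 0, ∃ V' ∈ 𝓝 s, ∃ ε' > 0, ∀ f, IsPeakingAt s V' ε' f →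
      ∀ m < M, ‖T f m‖ ≤ δ := by
    intro M δ hδ
    induction M with
    | zero => exact ⟨univ, univ_mem, 1, one_pos, fun f _ m hm => absurd hm (Nat.not_lt_zero m)⟩
    | succ M ih =>
      obtain ⟨V₁, hV₁, ε₁, hε₁, h₁⟩ := ih
      obtain ⟨V₂, hV₂, ε₂, hε₂, h₂⟩ := hsmall M δ hδ
      refine ⟨V₁ ∩ V₂, inter_mem hV₁ hV₂, min ε₁ ε₂, lt_min hε₁ hε₂, fun f hf m hm => ?_⟩
      rcases Nat.lt_succ_iff_lt_or_eq.1 hm with hm | rfl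
      · exact h₁ f (hf.mono inter_subset_left (min_le_left _ _)) m hm
      · exact (h₂ f (hf.mono inter_subset_right (min_le_right _ _))).le
  have hcoord : ∀ f, IsPeakingAt s V ε f → ∀ m, ‖T f m‖ ≤ ‖T‖ := fun f hf m =>
    (ZeroAtInftyContinuousMap.norm_apply_le _ m).trans ((T.le_opNorm f).trans
      (mul_le_of_le_one_right (norm_nonneg _) hf.norm_le))
  have hδ : 0 < κ / 2 := half_pos hκ
  -- `f` is an average of `N + 1` peak functions whose images are almost disjoint, of norm at most
  -- `‖T‖`.
  have hind : ∀ N : ℕ, ∃ f, IsPeakingAt s V ε f ∧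
      ∀ m, ((N : ℝ) + 1) * ‖T f m‖ ≤ ‖T‖ + (N + 1) * (κ / 2) := by
    intro N
    induction N with
    | zero =>
      obtain ⟨f, hf⟩ := exists_isPeakingAt hA hs hV hε
      refine ⟨f, hf, fun m => ?_⟩
      have := hcoord f hf m
      push_cast
      linarith
    | succ N ih =>
      obtain ⟨f, hf, hfm⟩ := ih
      have hN : (0 : ℝ) < N + 1 := by positivity
      have htail : ∀ᶠ m in atTop, ‖T f m‖ < κ / 2 / (N + 1) := by
        have h0 := zero_at_infty (T f)
        rw [cocompact_eq_cofinite, Nat.cofinite_eq_atTop] at h0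
        have h1 := h0.norm
        rw [norm_zero] at h1
        exact h1.eventually_lt_const (by positivity)
      obtain ⟨M, hM⟩ := eventually_atTop.1 htail
      obtain ⟨V', hV', ε', hε', hsm⟩ := hfin M _ hδ
      obtain ⟨g, hg⟩ := exists_isPeakingAt hA hs (inter_mem hV hV') (lt_min hε hε')
      have hgV := hg.mono inter_subset_left (min_le_left _ _)
      have hgm := hsm g (hg.mono inter_subset_right (min_le_right _ _))
      have hN2 : (0 : ℝ) < N + 2 := by positivity
      refine ⟨(((N + 1) / (N + 2) : ℝ) : ℂ) • f + ((1 / (N + 2) : ℝ) : ℂ) • g,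
        hf.convexCombination hgV (by positivity) (by positivity)
          (by field_simp; ring), fun m => ?_⟩
      have hbound : ‖T ((((N + 1) / (N + 2) : ℝ) : ℂ) • f + ((1 / (N + 2) : ℝ) : ℂ) • g) m‖
          ≤ (N + 1) / (N + 2) * ‖T f m‖ + 1 / (N + 2) * ‖T g m‖ := by
        rw [map_add, map_smul, map_smul]
        refine (norm_add_le _ _).trans_eq ?_
        change ‖(_ : ℂ) • T f m‖ + ‖(_ : ℂ) • T g m‖ = _
        rw [norm_smul, norm_smul, Complex.norm_of_nonneg (by positivity),
          Complex.norm_of_nonneg (by positivity)]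
      have hbound' := mul_le_mul_of_nonneg_left hbound hN2.le
      have hsplit : ((N : ℝ) + 2) * ((N + 1) / (N + 2) * ‖T f m‖ + 1 / (N + 2) * ‖T g m‖)
          = (N + 1) * ‖T f m‖ + ‖T g m‖ := by field_simp
      rw [hsplit] at hbound'
      have hgoal : ((N : ℝ) + 1) * ‖T f m‖ + ‖T g m‖ ≤ ‖T‖ + (N + 2) * (κ / 2) := by
        by_cases hm : m < M
        · linarith [hfm m, hgm m hm]
        · have h2 := (hM m (not_lt.1 hm)).le
          rw [le_div_iff₀ hN] at h2
          have : 0 ≤ (N + 1) * (κ / 2) := by positivity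
          linarith [hcoord g hgV m]
      rw [show ((N + 1 : ℕ) : ℝ) + 1 = N + 2 by push_cast; ring]
      exact hbound'.trans hgoal
  obtain ⟨N, hN⟩ := exists_nat_gt (‖T‖ / (κ / 2))
  rw [div_lt_iff₀ hδ] at hN
  obtain ⟨f, hf, hfm⟩ := hind N
  refine ⟨f, hf, ZeroAtInftyContinuousMap.norm_le_of_forall_le hκ.le fun m => ?_⟩
  have hN1 : (0 : ℝ) < N + 1 := by positivity
  refine le_of_mul_le_mul_left ((hfm m).trans ?_) hN1
  linarith

/-- Boundedness of an operator on a subspace. For a general normed space the norm topology of `E` is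
found to be its subspace topology, which instance search does not see for `E ≤ C₀(ℕ, ℂ)`. -/
theorem exists_pos_bound_of_subspace {X Y : Type*} [NormedAddCommGroup X] [NormedSpace ℂ X]
    [NormedAddCommGroup Y] [NormedSpace ℂ Y] (E : Submodule ℂ X) (S : E →L[ℂ] Y) :
    ∃ C > 0, ∀ e : E, ‖S e‖ ≤ C * ‖(e : X)‖ :=
  S.bound

/-- An operator that factors through a subspace of `c₀` is small at `s` on functions peaking at `s`,
for some `s` in each relatively open piece of the Choquet boundary. -/
theorem small_at_peak_of_factorsThroughSubspaceOfC0 [T2Space K] [Nonempty K]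
    (hA : IsFunctionAlgebra A) (hiso : Preperfect (choquetBoundary A))
    {T : FunctionAlgebraSpace A →L[ℂ] FunctionAlgebraSpace A} (hT : FactorsThroughSubspaceOfC0 T)
    {η : ℝ} (hη : 0 < η) {O : Set K} (hO : IsOpen O) (hne : (O ∩ choquetBoundary A).Nonempty) :
    ∃ s ∈ O ∩ choquetBoundary A, ∀ V ∈ 𝓝 s, ∀ ε > 0,
      ∃ f, IsPeakingAt s V ε f ∧ ‖incl A (T f) s‖ ≤ η := by
  obtain ⟨E, -, T₁, T₂, rfl⟩ := hT
  obtain ⟨C, hC, hbound⟩ := exists_pos_bound_of_subspace E T₂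
  let R : FunctionAlgebraSpace A →L[ℂ] C₀(ℕ, ℂ) := E.subtypeL.comp T₁
  let y : ℕ → StrongDual ℂ (FunctionAlgebraSpace A) := fun m =>
    LinearMap.mkContinuous
      { toFun := fun f => R f m
        map_add' := fun f g => by rw [map_add]; rfl
        map_smul' := fun c f => by rw [map_smul]; rfl } ‖R‖
      (fun f => (ZeroAtInftyContinuousMap.norm_apply_le _ m).trans (R.le_opNorm f))
  obtain ⟨s, hsO, hsZ⟩ := exists_mem_choquetBoundary_notMem_countable hA hiso hO hne
    (countable_setOf_large_at_peak y)
  refine ⟨s, hsO, fun V hV ε hε => ?_⟩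
  have hsmall : ∀ m, ∀ δ > 0, ∃ V ∈ 𝓝 s, ∃ ε > 0, ∀ f, IsPeakingAt s V ε f → ‖R f m‖ < δ := by
    by_contra! hcon
    exact hsZ hcon
  obtain ⟨f, hf, hRf⟩ := exists_isPeakingAt_norm_le hA R hsO.2 hsmall hV hε
    (κ := η / C) (by positivity)
  refine ⟨f, hf, (norm_apply_le _ s).trans ((hbound _).trans ?_)⟩
  have hRf' : ‖T₁ f‖ ≤ η / C := hRf
  rwa [le_div_iff₀ hC, mul_comm] at hRf'

end Daugavet

/-! ### The Daugavet equation -/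

theorem theorem3p3 {K : Type*} [TopologicalSpace K] [CompactSpace K] [T2Space K] [Nonempty K]
    (A : Subalgebra ℂ C(K, ℂ)) (hA : IsFunctionAlgebra A)
    (hiso : Preperfect (choquetBoundary A))
    (T : FunctionAlgebraSpace A →L[ℂ] FunctionAlgebraSpace A)
    (hT : IsWeaklyCompactOperator T ∨ FactorsThroughSubspaceOfC0 T) :
    ‖ContinuousLinearMap.id ℂ (FunctionAlgebraSpace A) + T‖ = 1 + ‖T‖ := by
  refine norm_id_add_eq_of_small_at_peak T fun η hη O hO hne => ?_
  rcases hT with hT | hT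
  · exact small_at_peak_of_isWeaklyCompactOperator hA hiso hT hη hO hne
  · exact small_at_peak_of_factorsThroughSubspaceOfC0 hA hiso hT hη hO hne
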